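/- Let $\Omega\subseteq\mathbb{C}$ be open, let $k,m\ge 1$, and let $M_n(\Omega,m)$ denote the set of complex $n\times n$ matrices whose spectrum lies in $\Omega$ and whose largest Jordan block has size at most $m$. Let $f$ be a complex function that is $(k+1)m-1$ times continuously (complex) differentiable on $\Omega$. For a square matrix $A$ with spectrum in $\Omega$, $f(A)$ denotes the usual (primary) matrix function: $f(A)=p(A)$ for any polynomial $p$ with $p^{(j)}(\lambda)=f^{(j)}(\lambda)$ for every eigenvalue $\lambda$ of $A$ and every $0\le j<n_\lambda$, where $n_\lambda$ is the size of the largest Jordan block of $A$ with eigenvalue $\lambda$. It is defined when the derivatives $f^{(j)}(\lambda)$, $0\le j<n_\lambda$, exist. The Fréchet derivatives of $f$ are defined recursively. Put $L_f^{(0)}(A)=f(A)$. For $j\ge1$, $L_f^{(j)}(A,\cdot,\dots,\cdot)$ exists if $L_f^{(j-1)}(B,\cdot,\dots,\cdot)$ exists for all $B$ in a neighbourhood of $A$ and there is a $j$-linear map $L_f^{(j)}(A,\cdot,\dots,\cdot)$ on $\mathbb{C}^{n\times n}$ with $$L_f^{(j-1)}(A+E_j,E_1,\dots,E_{j-1})-L_f^{(j-1)}(A,E_1,\dots,E_{j-1})=L_f^{(j)}(A,E_1,\dots,E_j)+o(\|E_j\|)$$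 as $E_j\to0$, for all fixed $E_1,\dots,E_{j-1}$. **Theorem.** Let $A_0,E_1,\dots,E_k\in\mathbb{C}^{n\times n}$ be such that $A_0+\sum_{i=1}^k x_iE_i\in M_n(\Omega,m)$ for all real $x=(x_1,\dots,x_k)$ in some neighbourhood of $0$. Then the $k$-th Fréchet derivative $L_f^{(k)}(A,\cdot,\dots,\cdot)$ exists for all $A$ in an open neighbourhood $U$ of $A_0$, and $(A,H_1,\dots,H_k)\mapsto L_f^{(k)}(A,H_1,\dots,H_k)$ is continuous on $U\times(\mathbb{C}^{n\times n})^k$. Moreover, with $$X_0=A_0,\qquad X_i=\begin{bmatrix}X_{i-1}& I_{2^{i-1}}\otimes E_i\\ 0& X_{i-1}\end{bmatrix},\quad i=1,\dots,k,$$ the matrix $f(X_k)$ is defined and $L_f^{(k)}(A_0,E_1,\dots,E_k)$ is equal to its upper right $n\times n$ block. -/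

import Mathlib

open Filter Topology Polynomial Asymptotics
open scoped Kronecker

/-- The Jordan block of size `d` with eigenvalue `μ`. -/
def jordanBlock (d : ℕ) (μ : ℂ) : Matrix (Fin d) (Fin d) ℂ :=
  Matrix.of fun a b => if a = b then μ else if (a : ℕ) + 1 = b then 1 else 0

/-- `A` has a Jordan canonical form `A = P J P⁻¹` all of whose Jordan blocks have size at
most `m`.  (The Jordan form is unique up to the order of the blocks, so this says that
the largest Jordan block of `A` has size at most `m`.) -/
def JordanBlocksLE {n : ℕ} (m : ℕ) (A : Matrix (Fin n) (Fin n) ℂ) : Prop :=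
  ∃ (r : ℕ) (d : Fin r → ℕ) (μ : Fin r → ℂ) (e : (Σ i, Fin (d i)) ≃ Fin n)
    (P : Matrix (Fin n) (Fin n) ℂ),
    IsUnit P.det ∧ (∀ i, d i ≤ m) ∧
    A = P * Matrix.reindex e e
      (Matrix.blockDiagonal' fun i => jordanBlock (d i) (μ i)) * P⁻¹

/-- The set `M_n(Ω, m)` of complex `n × n` matrices with spectrum in `Ω` and largest Jordan
block of size not exceeding `m`. -/
def matrixClass (n : ℕ) (Ω : Set ℂ) (m : ℕ) : Set (Matrix (Fin n) (Fin n) ℂ) :=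
  {A | spectrum ℂ A ⊆ Ω ∧ JordanBlocksLE m A}

/-- The index of `z` for `A`: the multiplicity of `z` as a root of the minimal polynomial,
that is, the size of the largest Jordan block with eigenvalue `z` (`0` if `z` is not an
eigenvalue). -/
noncomputable def eigenIndex {ι : Type} [Fintype ι] [DecidableEq ι]
    (A : Matrix ι ι ℂ) (z : ℂ) : ℕ :=
  (minpoly ℂ A).rootMultiplicity z

/-- `IsMatFun Ω f A B` says that the matrix function `f(A)`, for `f` a scalar function on
`Ω`, is defined and equal to `B`.  The spectrum of `A` lies in `Ω`, the derivatives
`f⁽ʲ⁾(z)` exist for each eigenvalue `z` and `j ≤ eigenIndex A z - 1`, and `B = p(A)` for a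
polynomial `p` that interpolates these derivatives (Hermite interpolation). -/
def IsMatFun {ι : Type} [Fintype ι] [DecidableEq ι] (Ω : Set ℂ) (f : ℂ → ℂ)
    (A B : Matrix ι ι ℂ) : Prop :=
  spectrum ℂ A ⊆ Ω ∧
  (∀ z j, j + 1 < eigenIndex A z → DifferentiableAt ℂ (iteratedDeriv j f) z) ∧
  ∃ p : ℂ[X], (∀ z j, j < eigenIndex A z →
      (Polynomial.derivative^[j] p).eval z = iteratedDeriv j f z) ∧
    B = Polynomial.aeval A p

/-- The value `f(A)` is unique. -/
theorem IsMatFun.unique {ι : Type} [Fintype ι] [DecidableEq ι] {Ω : Set ℂ} {f : ℂ → ℂ}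
    {A B C : Matrix ι ι ℂ} (hB : IsMatFun Ω f A B) (hC : IsMatFun Ω f A C) : B = C := by
  obtain ⟨-, -, p, hp, rfl⟩ := hB
  obtain ⟨-, -, q, hq, rfl⟩ := hC
  rw [← sub_eq_zero, ← map_sub]
  apply Polynomial.aeval_eq_zero_of_dvd_aeval_eq_zero _ (minpoly.aeval ℂ A)
  by_cases h0 : p - q = 0
  · simp [h0]
  have hm : (minpoly ℂ A).Monic := minpoly.monic (Algebra.IsIntegral.isIntegral A)
  rw [(IsAlgClosed.splits (minpoly ℂ A)).dvd_iff_roots_le_roots hm.ne_zero h0,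
    Multiset.le_iff_count]
  intro z
  rw [count_roots, count_roots]
  change eigenIndex A z ≤ _
  rcases Nat.eq_zero_or_pos (eigenIndex A z) with h | h
  · omega
  · have := (Polynomial.lt_rootMultiplicity_iff_isRoot_iterate_derivative
      (n := eigenIndex A z - 1) (t := z) h0).2 (by
        intro j hj
        have hj' : j < eigenIndex A z := by omega
        simp [Polynomial.IsRoot, hp z j hj', hq z j hj'])
    omega

section

/- All norms on the space of matrices are equivalent; the choice does not matter. -/
attribute [local instance] Matrix.linftyOpNormedAddCommGroup

/-- `IsFrechetDeriv Ω f k A L` says that the `k`-th Fréchet derivative of the matrix function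
`f` at `A` exists and is the `k`-linear map `L`.  For `k = 0` it is the value `f(A)`.  The
derivative of order `k + 1` is the `(k+1)`-linear map `L` with
`L⁽ᵏ⁾(A + H, E₁, …, E_k) - L⁽ᵏ⁾(A, E₁, …, E_k) = L(E₁, …, E_k, H) + o(‖H‖)`, where the
derivative `L⁽ᵏ⁾` of order `k` exists in a neighbourhood of `A`. -/
def IsFrechetDeriv {n : ℕ} (Ω : Set ℂ) (f : ℂ → ℂ) :
    (k : ℕ) → Matrix (Fin n) (Fin n) ℂ →
      MultilinearMap ℂ (fun _ : Fin k => Matrix (Fin n) (Fin n) ℂ)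
        (Matrix (Fin n) (Fin n) ℂ) → Prop
  | 0, A, L => IsMatFun Ω f A (L Fin.elim0)
  | k + 1, A, L =>
    ∃ G : Matrix (Fin n) (Fin n) ℂ →
        MultilinearMap ℂ (fun _ : Fin k => Matrix (Fin n) (Fin n) ℂ)
          (Matrix (Fin n) (Fin n) ℂ),
      (∀ᶠ B in 𝓝 A, IsFrechetDeriv Ω f k B (G B)) ∧
      ∀ E : Fin k → Matrix (Fin n) (Fin n) ℂ,
        (fun H : Matrix (Fin n) (Fin n) ℂ =>
          G (A + H) E - G A E - L (Fin.snoc E H)) =o[𝓝 0] fun H => H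

end

/-- Two consecutive groups of `2 ^ i` blocks of size `n` make `2 ^ (i + 1)` blocks. -/
def blockEquiv (n i : ℕ) :
    (Fin (2 ^ i) × Fin n) ⊕ (Fin (2 ^ i) × Fin n) ≃ Fin (2 ^ (i + 1)) × Fin n :=
  (Equiv.sumProdDistrib (Fin (2 ^ i)) (Fin (2 ^ i)) (Fin n)).symm.trans
    (Equiv.prodCongr (finSumFinEquiv.trans (finCongr (by rw [pow_succ, mul_two])))
      (Equiv.refl (Fin n)))

/-- The matrix `X_i` of size `2 ^ i n`: `X_0 = A` and
`X_i = [[X_{i-1}, I ⊗ E_i], [0, X_{i-1}]]`, with `I` of size `2 ^ (i-1)`. -/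
def blockX {n : ℕ} (A : Matrix (Fin n) (Fin n) ℂ) :
    (i : ℕ) → (Fin i → Matrix (Fin n) (Fin n) ℂ) →
      Matrix (Fin (2 ^ i) × Fin n) (Fin (2 ^ i) × Fin n) ℂ
  | 0, _ => (1 : Matrix (Fin (2 ^ 0)) (Fin (2 ^ 0)) ℂ) ⊗ₖ A
  | i + 1, E =>
    Matrix.reindex (blockEquiv n i) (blockEquiv n i)
      (Matrix.fromBlocks (blockX A i (Fin.init E))
        ((1 : Matrix (Fin (2 ^ i)) (Fin (2 ^ i)) ℂ) ⊗ₖ E (Fin.last i))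
        0 (blockX A i (Fin.init E)))

/-- The upper right `n × n` block of a matrix of `2 ^ k × 2 ^ k` blocks of size `n`. -/
def upperRightBlock {n k : ℕ}
    (F : Matrix (Fin (2 ^ k) × Fin n) (Fin (2 ^ k) × Fin n) ℂ) :
    Matrix (Fin n) (Fin n) ℂ :=
  Matrix.of fun a b =>
    F (⟨0, Nat.two_pow_pos k⟩, a) (⟨2 ^ k - 1, Nat.sub_lt (Nat.two_pow_pos k) one_pos⟩, b)

/-!
The order of differentiability `(k + 1) m - 1` is at least `1`, and `f` is complex differentiable
on an open set, so `f` is holomorphic on `Ω`. For holomorphic `f` the matrix function is smooth on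
the open set of all matrices with spectrum in `Ω`, and the derivatives can be computed one at a
time.

The core is first-order differentiability, for matrices of any size
(`exists_hasFDerivAt_matFun`). Let `q` be the characteristic polynomial of `X`. Newton
interpolation at the roots of `q²` gives `f = p + q² h` with a polynomial `p` and a holomorphic
`h`, hence `f(B) = p(B) + q(B)² h(B)` for all `B` near `X`. Here `q(B) = O(B - X)` by
Cayley-Hamilton, and `h(B)` stays bounded (`exists_eventually_norm_matFun_le`), because the
divided differences of `h` near the spectrum of `X` are bounded by the maximum modulus principle.
So `f` has the same derivative at `X` as `p`. As `q²` annihilates `[[X, Y], [0, X]]`, the value of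
`f` at this block matrix is that of `p`, whose upper right block is the derivative of `p` at `X`
in the direction `Y`.

Replacing `A` by `A + H` adds `I ⊗ H` to `X_k`. Applied to `X_k`, the first-order result
therefore says that the derivative in `A` of the upper right block of `f(X_k)` is the upper right
block of `f(X_{k+1})` with `E_{k+1} = H` (`exists_hasFDerivAt_frechetBlock`). By induction these
blocks are multilinear in `E`, and they are the Fréchet derivatives. They are continuous in
`(A, E)`, since `X_k` is and `f` is differentiable at each `X_k`.
-/

/-! ### Newton interpolation and the matrix function -/

/-- The Newton form of the polynomial that interpolates `f` at the nodes of the list `l`, with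
multiplicity.  Its coefficients, the divided differences of `f`, are values of the iterated
`dslope`s of `f`. -/
noncomputable def newtonPoly (f : ℂ → ℂ) : List ℂ → ℂ[X]
  | [] => 0
  | a :: l => C (f a) + (X - C a) * newtonPoly (dslope f a) l

/-- The last divided difference `z ↦ f[a₁, …, a_r, z]` in the Newton interpolation of `f`. -/
noncomputable def newtonRem (f : ℂ → ℂ) : List ℂ → ℂ → ℂ
  | [] => f
  | a :: l => newtonRem (dslope f a) l

/-- The monic polynomial whose list of roots is `l`. -/
noncomputable def nodePoly (l : List ℂ) : ℂ[X] :=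
  (l.map fun a => X - C a).prod

/-- Newton interpolation with its remainder, an identity for every function `f`: no smoothness is
needed, as the value of `dslope` at the node does not matter here. -/
lemma eq_newtonPoly_add (f : ℂ → ℂ) (l : List ℂ) (z : ℂ) :
    f z = (newtonPoly f l).eval z + (nodePoly l).eval z * newtonRem f l z := by
  induction l generalizing f with
  | nil => simp [newtonPoly, newtonRem, nodePoly]
  | cons a l ih =>
    have h1 := ih (dslope f a)
    have h2 := sub_smul_dslope f a z
    rw [smul_eq_mul] at h2
    simp only [newtonPoly, newtonRem, nodePoly, List.map_cons, List.prod_cons, eval_add, eval_C,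
      eval_mul, eval_sub, eval_X] at h1 ⊢
    linear_combination (z - a) * h1 - h2

lemma differentiableOn_newtonRem {f : ℂ → ℂ} {Ω : Set ℂ} (hΩ : IsOpen Ω)
    (hf : DifferentiableOn ℂ f Ω) (l : List ℂ) (hl : ∀ a ∈ l, a ∈ Ω) :
    DifferentiableOn ℂ (newtonRem f l) Ω := by
  induction l generalizing f with
  | nil => exact hf
  | cons a l ih =>
    exact ih ((Complex.differentiableOn_dslope (hΩ.mem_nhds (hl a (by simp)))).2 hf)
      fun b hb => hl b (by simp [hb])

lemma nodePoly_append (l l' : List ℂ) : nodePoly (l ++ l') = nodePoly l * nodePoly l' := by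
  simp [nodePoly]

lemma charpoly_eq_nodePoly {ι : Type} [Fintype ι] [DecidableEq ι] (A : Matrix ι ι ℂ) :
    A.charpoly = nodePoly A.charpoly.roots.toList := by
  conv_lhs => rw [(IsAlgClosed.splits A.charpoly).eq_prod_roots_of_monic A.charpoly_monic]
  rw [nodePoly, ← Multiset.prod_coe, ← Multiset.map_coe, Multiset.coe_toList]

lemma mem_spectrum_iff_mem_roots_charpoly {ι : Type} [Fintype ι] [DecidableEq ι]
    {A : Matrix ι ι ℂ} {z : ℂ} : z ∈ spectrum ℂ A ↔ z ∈ A.charpoly.roots.toList := by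
  rw [Matrix.mem_spectrum_iff_isRoot_charpoly, Multiset.mem_toList,
    mem_roots A.charpoly_monic.ne_zero]

lemma iteratedDeriv_eval (p : ℂ[X]) (j : ℕ) :
    iteratedDeriv j (fun z => p.eval z) = fun z => (Polynomial.derivative^[j] p).eval z := by
  induction j with
  | zero => simp
  | succ j ih =>
    rw [iteratedDeriv_succ, ih, Function.iterate_succ_apply']
    funext z
    simp

/-- `f(A) = p(A)` as soon as `f - p` is, on `Ω`, a holomorphic multiple of a polynomial `q`
that annihilates `A`: then `f - p` vanishes at each eigenvalue to the order of its index. -/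
lemma isMatFun_aeval {ι : Type} [Fintype ι] [DecidableEq ι] {Ω : Set ℂ} (hΩ : IsOpen Ω)
    {f h : ℂ → ℂ} (hh : DifferentiableOn ℂ h Ω) {A : Matrix ι ι ℂ} (hA : spectrum ℂ A ⊆ Ω)
    {p q : ℂ[X]} (hq : aeval A q = 0)
    (hfp : ∀ z ∈ Ω, f z = p.eval z + q.eval z * h z) :
    IsMatFun Ω f A (aeval A p) := by
  have hf : DifferentiableOn ℂ f Ω := by
    refine DifferentiableOn.congr ?_ hfp
    exact p.differentiable.differentiableOn.add (q.differentiable.differentiableOn.mul hh)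
  have hmem : ∀ z j, j < eigenIndex A z → z ∈ Ω := by
    intro z j hj
    refine hA ?_
    rw [Matrix.mem_spectrum_iff_isRoot_charpoly]
    refine IsRoot.dvd ?_ (Matrix.minpoly_dvd_charpoly A)
    exact (rootMultiplicity_pos (minpoly.ne_zero (Algebra.IsIntegral.isIntegral A))).1
      (by unfold eigenIndex at hj; omega)
  refine ⟨hA, ?_, p, ?_, rfl⟩
  · intro z j hj
    have hz := hΩ.mem_nhds (hmem z _ hj)
    have hfz : AnalyticAt ℂ f z := hf.analyticAt hz
    rw [iteratedDeriv_eq_iterate]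
    exact (hfz.iterated_deriv j).differentiableAt
  · intro z j hj
    have hz := hΩ.mem_nhds (hmem z _ hj)
    have hfz : AnalyticAt ℂ f z := hf.analyticAt hz
    have hpz : AnalyticAt ℂ (fun w => p.eval w) z :=
      p.differentiable.differentiableOn.analyticAt univ_mem
    have key : ((eigenIndex A z : ℕ) : ℕ∞) ≤ analyticOrderAt (f - fun w => p.eval w) z := by
      rw [natCast_le_analyticOrderAt (hfz.sub hpz)]
      obtain ⟨u, hu⟩ : (X - C z) ^ eigenIndex A z ∣ q :=
        (pow_rootMultiplicity_dvd _ _).trans (minpoly.dvd ℂ A hq)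
      refine ⟨fun w => u.eval w * h w, ?_, ?_⟩
      · exact AnalyticAt.mul (u.differentiable.differentiableOn.analyticAt univ_mem)
          (hh.analyticAt hz)
      · filter_upwards [hz] with w hw
        rw [Pi.sub_apply, hfp w hw, hu]
        simp
        ring
    have := (natCast_le_analyticOrderAt_iff_iteratedDeriv_eq_zero (hfz.sub hpz)).1 key j hj
    rw [iteratedDeriv_sub hfz.contDiffAt hpz.contDiffAt, iteratedDeriv_eval, sub_eq_zero] at this
    exact this.symm

/-- The matrix function `f(A)`, given by Newton interpolation of `f` at the eigenvalues of `A`,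
taken with their algebraic multiplicities. -/
noncomputable def matFun {ι : Type} [Fintype ι] [DecidableEq ι] (f : ℂ → ℂ)
    (A : Matrix ι ι ℂ) : Matrix ι ι ℂ :=
  aeval A (newtonPoly f A.charpoly.roots.toList)

lemma isMatFun_matFun {ι : Type} [Fintype ι] [DecidableEq ι] {Ω : Set ℂ} (hΩ : IsOpen Ω)
    {f : ℂ → ℂ} (hf : DifferentiableOn ℂ f Ω) {A : Matrix ι ι ℂ} (hA : spectrum ℂ A ⊆ Ω) :
    IsMatFun Ω f A (matFun f A) := by
  refine isMatFun_aeval hΩ (differentiableOn_newtonRem hΩ hf A.charpoly.roots.toList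
    fun a ha => hA (mem_spectrum_iff_mem_roots_charpoly.2 ha)) hA
    (q := nodePoly A.charpoly.roots.toList) ?_ fun z _ => eq_newtonPoly_add f _ z
  rw [← charpoly_eq_nodePoly, Matrix.aeval_self_charpoly]

lemma matFun_eq_aeval {ι : Type} [Fintype ι] [DecidableEq ι] {Ω : Set ℂ} (hΩ : IsOpen Ω)
    {f h : ℂ → ℂ} (hh : DifferentiableOn ℂ h Ω) {A : Matrix ι ι ℂ} (hA : spectrum ℂ A ⊆ Ω)
    {p q : ℂ[X]} (hq : aeval A q = 0)
    (hfp : ∀ z ∈ Ω, f z = p.eval z + q.eval z * h z) :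
    matFun f A = aeval A p := by
  have hf : DifferentiableOn ℂ f Ω :=
    (p.differentiable.differentiableOn.add (q.differentiable.differentiableOn.mul hh)).congr hfp
  exact (isMatFun_matFun hΩ hf hA).unique (isMatFun_aeval hΩ hh hA hq hfp)

lemma matFun_reindex {ι κ : Type} [Fintype ι] [DecidableEq ι] [Fintype κ] [DecidableEq κ]
    (f : ℂ → ℂ) (e : ι ≃ κ) (A : Matrix ι ι ℂ) :
    matFun f (Matrix.reindex e e A) = Matrix.reindex e e (matFun f A) := by
  rw [matFun, matFun, Matrix.charpoly_reindex]
  exact aeval_algHom_apply (Matrix.reindexAlgEquiv ℂ ℂ e) A _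

/-! ### Bounds for divided differences -/

section LocalBound

/-- Divided differences of a function bounded on the closure of `U` are bounded there: on the
frontier this is clear since the nodes stay away from it, and the maximum modulus principle
carries the bound inside. -/
lemma norm_dslope_le {U : Set ℂ} (hU : Bornology.IsBounded U) {Ω : Set ℂ} (hΩ : IsOpen Ω)
    (hUΩ : closure U ⊆ Ω) {f : ℂ → ℂ} (hf : DifferentiableOn ℂ f Ω) {M δ : ℝ} (hδ : 0 < δ)
    (hM : ∀ z ∈ closure U, ‖f z‖ ≤ M) {a : ℂ} (ha : a ∈ closure U)
    (hfr : ∀ z ∈ frontier U, δ ≤ ‖z - a‖) :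
    ∀ z ∈ closure U, ‖dslope f a z‖ ≤ 2 * M / δ := by
  intro z hz
  have hd : DifferentiableOn ℂ (dslope f a) Ω :=
    (Complex.differentiableOn_dslope (hΩ.mem_nhds (hUΩ ha))).2 hf
  refine Complex.norm_le_of_forall_mem_frontier_norm_le hU
    (hd.mono hUΩ).diffContOnCl (fun w hw => ?_) hz
  have h1 := hfr w hw
  have h2 : ‖w - a‖ * ‖dslope f a w‖ ≤ 2 * M := by
    rw [← norm_mul, ← smul_eq_mul, sub_smul_dslope]
    linarith [norm_sub_le (f w) (f a), hM w (frontier_subset_closure hw), hM a ha]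
  rw [le_div_iff₀ hδ]
  nlinarith [norm_nonneg (dslope f a w)]

variable {R : Type*} [NormedRing R] [NormedAlgebra ℂ R]

/-- The Newton polynomials of all functions with a common bound, at any nodes that stay away
from the frontier of `U`, are uniformly bounded at bounded arguments. -/
lemma exists_norm_aeval_newtonPoly_le {U : Set ℂ} (hU : Bornology.IsBounded U) {Ω : Set ℂ}
    (hΩ : IsOpen Ω) (hUΩ : closure U ⊆ Ω) {δ : ℝ} (hδ : 0 < δ) (N : ℝ) (s : ℕ) (M : ℝ) :
    ∃ K : ℝ, ∀ f : ℂ → ℂ, DifferentiableOn ℂ f Ω → (∀ z ∈ closure U, ‖f z‖ ≤ M) →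
      ∀ l : List ℂ, l.length = s →
        (∀ a ∈ l, a ∈ closure U ∧ ∀ z ∈ frontier U, δ ≤ ‖z - a‖) →
        ∀ B : R, ‖B‖ ≤ N → ‖aeval B (newtonPoly f l)‖ ≤ K := by
  obtain ⟨r, hr⟩ := hU.closure.exists_norm_le
  induction s generalizing M with
  | zero =>
    refine ⟨0, fun f _ _ l hl _ B _ => ?_⟩
    rw [List.length_eq_zero_iff] at hl
    simp [hl, newtonPoly]
  | succ s ih =>
    obtain ⟨K, hK⟩ := ih (2 * M / δ)
    refine ⟨M * ‖(1 : R)‖ + (N + r * ‖(1 : R)‖) * K, fun f hf hM l hl hn B hB => ?_⟩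
    obtain _ | ⟨a, l⟩ := l
    · simp at hl
    obtain ⟨ha, hfr⟩ := hn a (by simp)
    have h1 := hK (dslope f a) ((Complex.differentiableOn_dslope (hΩ.mem_nhds (hUΩ ha))).2 hf)
      (norm_dslope_le hU hΩ hUΩ hf hδ hM ha hfr) l (by simpa using hl)
      (fun b hb => hn b (by simp [hb])) B hB
    have h2 : ‖algebraMap ℂ R (f a)‖ ≤ M * ‖(1 : R)‖ := by
      rw [norm_algebraMap]
      gcongr
      exact hM a ha
    have h3 : ‖B - algebraMap ℂ R a‖ ≤ N + r * ‖(1 : R)‖ := by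
      refine (norm_sub_le _ _).trans ?_
      rw [norm_algebraMap]
      gcongr
      exact hr a ha
    simp only [newtonPoly, map_add, map_mul, map_sub, aeval_C, aeval_X]
    refine (norm_add_le _ _).trans (add_le_add h2 ((norm_mul_le _ _).trans ?_))
    gcongr
    exact (norm_nonneg _).trans h3

end LocalBound

/-! ### Differentiability of the matrix function -/

section Derivative

attribute [local instance] Matrix.linftyOpNormedRing Matrix.linftyOpNormedAlgebra

variable {ι : Type} [Fintype ι] [DecidableEq ι]

lemma eventually_spectrum_subset {Ω : Set ℂ} (hΩ : IsOpen Ω) {X : Matrix ι ι ℂ}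
    (hX : spectrum ℂ X ⊆ Ω) : ∀ᶠ B in 𝓝 X, spectrum ℂ B ⊆ Ω := by
  have : CompleteSpace (Matrix ι ι ℂ) := FiniteDimensional.complete ℂ _
  exact upperHemicontinuous_iff_forall_isOpen.1
    (upperHemicontinuous_spectrum ℂ (Matrix ι ι ℂ)) X Ω hΩ hX

/-- The eigenvalues of `B` near `X` stay away from the boundary of a neighbourhood of the
spectrum of `X`, so the Newton polynomials that define `matFun f B` are uniformly bounded. -/
lemma exists_eventually_norm_matFun_le {Ω : Set ℂ} (hΩ : IsOpen Ω) {f : ℂ → ℂ}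
    (hf : DifferentiableOn ℂ f Ω) {X : Matrix ι ι ℂ} (hX : spectrum ℂ X ⊆ Ω) :
    ∃ K : ℝ, ∀ᶠ B in 𝓝 X, ‖matFun f B‖ ≤ K := by
  have : CompleteSpace (Matrix ι ι ℂ) := FiniteDimensional.complete ℂ _
  have hc : IsCompact (spectrum ℂ X) := spectrum.isCompact X
  obtain ⟨δ, hδ, hδΩ⟩ := hc.exists_cthickening_subset_open hΩ hX
  set U := Metric.thickening δ (spectrum ℂ X) with hU
  have hUc : closure U ⊆ Metric.cthickening δ (spectrum ℂ X) :=
    Metric.closure_thickening_subset_cthickening _ _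
  obtain ⟨M, hM⟩ := (hc.cthickening (r := δ)).exists_bound_of_continuousOn
    (hf.continuousOn.mono hδΩ)
  obtain ⟨K, hK⟩ := exists_norm_aeval_newtonPoly_le (R := Matrix ι ι ℂ)
    (hc.isBounded.thickening (δ := δ)) hΩ (hUc.trans hδΩ) (half_pos hδ) (‖X‖ + 1)
    (Fintype.card ι) M
  refine ⟨K, ?_⟩
  have hB1 : ∀ᶠ B in 𝓝 X, spectrum ℂ B ⊆ Metric.thickening (δ / 2) (spectrum ℂ X) :=
    eventually_spectrum_subset Metric.isOpen_thickening
      (Metric.self_subset_thickening (half_pos hδ) _)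
  have hB2 : ∀ᶠ B in 𝓝 X, ‖B‖ < ‖X‖ + 1 :=
    continuous_norm.continuousAt.eventually_lt continuousAt_const (by simp)
  filter_upwards [hB1, hB2] with B h1 h2
  refine hK f hf (fun z hz => hM z (hUc hz)) _ ?_ (fun a ha => ?_) B h2.le
  · rw [Multiset.length_toList, ← (IsAlgClosed.splits B.charpoly).natDegree_eq_card_roots,
      Matrix.charpoly_natDegree_eq_dim]
  · have ha' := h1 (mem_spectrum_iff_mem_roots_charpoly.2 ha)
    refine ⟨subset_closure (Metric.thickening_mono (by linarith) _ ha'), fun z hz => ?_⟩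
    obtain ⟨b, hb, hab⟩ := Metric.mem_thickening_iff.1 ha'
    have hzU : z ∉ U := by
      have : IsOpen U := Metric.isOpen_thickening
      rw [this.frontier_eq] at hz
      exact hz.2
    have hzb : δ ≤ dist z b := by
      by_contra! hlt
      exact hzU (Metric.mem_thickening_iff.2 ⟨b, hb, hlt⟩)
    rw [← dist_eq_norm]
    linarith [dist_triangle z a b]

/-- A polynomial of a `2 × 2` block triangular matrix carries the derivative of the polynomial
in its upper right block. -/
lemma exists_hasFDerivAt_aeval (p : ℂ[X]) (X : Matrix ι ι ℂ) :
    ∃ D : Matrix ι ι ℂ →L[ℂ] Matrix ι ι ℂ, HasFDerivAt (fun B => aeval B p) D X ∧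
      ∀ Y, aeval (Matrix.fromBlocks X Y 0 X) p =
        Matrix.fromBlocks (aeval X p) (D Y) 0 (aeval X p) := by
  induction p using Polynomial.induction_on with
  | C a =>
    refine ⟨0, by simpa using hasFDerivAt_const _ _, fun Y => ?_⟩
    simp only [aeval_C, _root_.zero_apply, Algebra.algebraMap_eq_smul_one,
      ← Matrix.fromBlocks_one, Matrix.fromBlocks_smul, smul_zero]
  | add p q hp hq =>
    obtain ⟨D, hD, hDY⟩ := hp
    obtain ⟨D', hD', hDY'⟩ := hq
    refine ⟨D + D', by simpa only [map_add] using! hD.add hD', fun Y => ?_⟩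
    simp [hDY, hDY', Matrix.fromBlocks_add]
  | monomial n a h =>
    obtain ⟨D, hD, hDY⟩ := h
    rw [pow_succ, ← mul_assoc]
    refine ⟨_, (hD.mul' (hasFDerivAt_id X)).congr_of_eventuallyEq ?_, fun Y => ?_⟩
    · exact .of_forall fun B => by simp only [map_mul (aeval B) _ Polynomial.X, aeval_X]; rfl
    · rw [map_mul, hDY, aeval_X, Matrix.fromBlocks_multiply, map_mul (aeval X) _ Polynomial.X,
        aeval_X, mul_zero, mul_zero, zero_mul, zero_mul, add_zero, zero_add, zero_add]
      rfl

lemma spectrum_fromBlocks_self (X Y : Matrix ι ι ℂ) :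
    spectrum ℂ (Matrix.fromBlocks X Y 0 X) = spectrum ℂ X := by
  ext z
  simp [Matrix.mem_spectrum_iff_isRoot_charpoly, Matrix.charpoly_fromBlocks_zero₂₁,
    IsRoot.def]

/-- The matrix function of a holomorphic `f` is differentiable, and its derivative at `X` in the
direction `Y` is the upper right block of its value at the block matrix `[[X, Y], [0, X]]`.
With `q` the characteristic polynomial of `X`, write `f = p + q² h`; then
`f(B) = p(B) + q(B)² h(B)` with `q(B) = O(B - X)` and `h(B) = O(1)`, while `q²` annihilates the
block matrix. -/
theorem exists_hasFDerivAt_matFun {Ω : Set ℂ} (hΩ : IsOpen Ω) {f : ℂ → ℂ}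
    (hf : DifferentiableOn ℂ f Ω) {X : Matrix ι ι ℂ} (hX : spectrum ℂ X ⊆ Ω) :
    ∃ D : Matrix ι ι ℂ →L[ℂ] Matrix ι ι ℂ, HasFDerivAt (matFun f) D X ∧
      ∀ Y, (matFun f (Matrix.fromBlocks X Y 0 X)).toBlocks₁₂ = D Y := by
  set l := X.charpoly.roots.toList with hl
  set q := nodePoly l with hq
  have hlΩ : ∀ a ∈ l ++ l, a ∈ Ω := fun a ha =>
    hX (mem_spectrum_iff_mem_roots_charpoly.2 ((List.mem_append.1 ha).elim id id))
  have hqX : aeval X q = 0 := by rw [hq, ← charpoly_eq_nodePoly, Matrix.aeval_self_charpoly]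
  set p := newtonPoly f (l ++ l) with hp
  set h := newtonRem f (l ++ l) with hh
  have hhd : DifferentiableOn ℂ h Ω := differentiableOn_newtonRem hΩ hf _ hlΩ
  have hfp : ∀ z, f z = p.eval z + (q * q).eval z * h z := fun z => by
    rw [hq, ← nodePoly_append]
    exact eq_newtonPoly_add f _ z
  obtain ⟨D, hD, hDY⟩ := exists_hasFDerivAt_aeval p X
  obtain ⟨D', hD', hDY'⟩ := exists_hasFDerivAt_aeval q X
  refine ⟨D, ?_, fun Y => ?_⟩
  -- If `h` agrees with `r` at the eigenvalues of `B`, with multiplicity, then so does `f` with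
  -- `p + q² r`.
  · have hev : ∀ᶠ B in 𝓝 X, matFun f B = aeval B p + aeval B q * (aeval B q * matFun h B) := by
      filter_upwards [eventually_spectrum_subset hΩ hX] with B hB
      have hBl : ∀ a ∈ B.charpoly.roots.toList, a ∈ Ω := fun a ha =>
        hB (mem_spectrum_iff_mem_roots_charpoly.2 ha)
      rw [matFun_eq_aeval hΩ (p := p + q * (q * newtonPoly h B.charpoly.roots.toList))
        (q := nodePoly B.charpoly.roots.toList)
        (h := fun z => q.eval z * q.eval z * newtonRem h B.charpoly.roots.toList z) ?_ hB ?_ ?_]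
      · simp only [map_add, map_mul, matFun]
      · exact (q.differentiable.differentiableOn.mul q.differentiable.differentiableOn).mul
          (differentiableOn_newtonRem hΩ hhd _ hBl)
      · rw [← charpoly_eq_nodePoly, Matrix.aeval_self_charpoly]
      · intro z _
        rw [hfp z, eq_newtonPoly_add h B.charpoly.roots.toList z]
        simp only [eval_add, eval_mul]
        ring
    obtain ⟨K, hK⟩ := exists_eventually_norm_matFun_le hΩ hhd hX
    have hq1 : (fun B => aeval B q) =O[𝓝 X] fun B => ‖B - X‖ := by
      have := hD'.isBigO_sub.norm_right
      simp only [hqX, sub_zero] at this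
      exact this
    have hh1 : (fun B => matFun h B) =O[𝓝 X] fun _ => (1 : ℝ) :=
      IsBigO.of_bound K (by simpa using hK)
    have hrem : HasFDerivAt (fun B => aeval B q * (aeval B q * matFun h B))
        (0 : Matrix ι ι ℂ →L[ℂ] Matrix ι ι ℂ) X := by
      refine IsBigO.hasFDerivAt (n := 2) ?_ one_lt_two
      simp only [pow_two]
      simpa only [mul_one] using! hq1.mul (hq1.mul hh1)
    exact ((hD.add hrem).congr_fderiv (add_zero D)).congr_of_eventuallyEq hev
  -- At the block matrix `q` takes the value `[[0, *], [0, 0]]`, whose square is zero.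
  · rw [matFun_eq_aeval hΩ hhd (by rwa [spectrum_fromBlocks_self]) (p := p) ?_
      fun z _ => hfp z, hDY, Matrix.toBlocks_fromBlocks₁₂]
    rw [map_mul, hDY', hqX, Matrix.fromBlocks_multiply]
    simp

end Derivative

/-! ### The block matrices -/

section BlockStructure

lemma blockEquiv_inl {n i : ℕ} (a : Fin (2 ^ i)) (x : Fin n) :
    blockEquiv n i (.inl (a, x)) = (⟨a, by rw [pow_succ]; omega⟩, x) := by
  simp [blockEquiv, Fin.ext_iff]

lemma blockEquiv_inr {n i : ℕ} (a : Fin (2 ^ i)) (x : Fin n) :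
    blockEquiv n i (.inr (a, x)) = (⟨2 ^ i + a, by rw [pow_succ]; omega⟩, x) := by
  simp [blockEquiv, Fin.ext_iff, add_comm]

lemma reindex_blockEquiv_one_kronecker {n : ℕ} (i : ℕ) (H : Matrix (Fin n) (Fin n) ℂ) :
    Matrix.reindex (blockEquiv n i) (blockEquiv n i)
      (Matrix.fromBlocks ((1 : Matrix (Fin (2 ^ i)) (Fin (2 ^ i)) ℂ) ⊗ₖ H) 0 0
        ((1 : Matrix (Fin (2 ^ i)) (Fin (2 ^ i)) ℂ) ⊗ₖ H)) =
      (1 : Matrix (Fin (2 ^ (i + 1))) (Fin (2 ^ (i + 1))) ℂ) ⊗ₖ H := by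
  rw [← Equiv.eq_symm_apply]
  ext (⟨a, x⟩ | ⟨a, x⟩) (⟨b, y⟩ | ⟨b, y⟩) <;>
  · have := a.isLt
    have := b.isLt
    simp only [Matrix.reindex_symm, Matrix.reindex_apply, Equiv.symm_symm, Matrix.submatrix_apply,
      Matrix.fromBlocks_apply₁₁, Matrix.fromBlocks_apply₁₂, Matrix.fromBlocks_apply₂₁,
      Matrix.fromBlocks_apply₂₂, blockEquiv_inl, blockEquiv_inr, Matrix.kroneckerMap_apply,
      Matrix.one_apply, Fin.ext_iff, Matrix.zero_apply] <;> grind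

lemma upperRightBlock_reindex {n k : ℕ}
    (M : Matrix ((Fin (2 ^ k) × Fin n) ⊕ (Fin (2 ^ k) × Fin n))
      ((Fin (2 ^ k) × Fin n) ⊕ (Fin (2 ^ k) × Fin n)) ℂ) :
    upperRightBlock (k := k + 1) (Matrix.reindex (blockEquiv n k) (blockEquiv n k) M) =
      upperRightBlock M.toBlocks₁₂ := by
  ext x y
  have h1 : (blockEquiv n k).symm (⟨0, Nat.two_pow_pos (k + 1)⟩, x) =
      .inl (⟨0, Nat.two_pow_pos k⟩, x) := by
    rw [Equiv.symm_apply_eq, blockEquiv_inl]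
  have h2 : (blockEquiv n k).symm
      (⟨2 ^ (k + 1) - 1, Nat.sub_lt (Nat.two_pow_pos (k + 1)) one_pos⟩, y) =
      .inr (⟨2 ^ k - 1, Nat.sub_lt (Nat.two_pow_pos k) one_pos⟩, y) := by
    rw [Equiv.symm_apply_eq, blockEquiv_inr]
    have := Nat.two_pow_pos k
    simp only [Prod.mk.injEq, Fin.mk.injEq, and_true]
    omega
  simp only [upperRightBlock, Matrix.of_apply, Matrix.reindex_apply, Matrix.submatrix_apply,
    Matrix.toBlocks₁₂, h1, h2]

/-- Translating `A` by `H` translates every diagonal block of `X_k` by `H`. -/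
lemma blockX_add {n : ℕ} (A H : Matrix (Fin n) (Fin n) ℂ) (k : ℕ)
    (E : Fin k → Matrix (Fin n) (Fin n) ℂ) :
    blockX (A + H) k E =
      blockX A k E + (1 : Matrix (Fin (2 ^ k)) (Fin (2 ^ k)) ℂ) ⊗ₖ H := by
  induction k with
  | zero => exact Matrix.kronecker_add 1 A H
  | succ k ih =>
    rw [← reindex_blockEquiv_one_kronecker]
    simp only [blockX, ih, ← Matrix.coe_reindexLinearEquiv ℂ ℂ]
    rw [← map_add, Matrix.fromBlocks_add]
    simp only [add_zero]

/-- The identification of the indices of a matrix with those of a single block. -/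
def oneBlockEquiv (n : ℕ) : Fin n ≃ Fin (2 ^ 0) × Fin n :=
  (Equiv.uniqueProd (Fin n) (Fin 1)).symm.trans
    (Equiv.prodCongr (finCongr (pow_zero 2).symm) (Equiv.refl (Fin n)))

lemma blockX_zero_eq_reindex {n : ℕ} (A : Matrix (Fin n) (Fin n) ℂ)
    (E : Fin 0 → Matrix (Fin n) (Fin n) ℂ) :
    blockX A 0 E = Matrix.reindex (oneBlockEquiv n) (oneBlockEquiv n) A := by
  ext ⟨a, x⟩ ⟨b, y⟩
  have hab : a = b := Subsingleton.elim (α := Fin 1) a b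
  simp [blockX, hab, oneBlockEquiv]

lemma spectrum_blockX {n : ℕ} (A : Matrix (Fin n) (Fin n) ℂ) (k : ℕ)
    (E : Fin k → Matrix (Fin n) (Fin n) ℂ) : spectrum ℂ (blockX A k E) = spectrum ℂ A := by
  induction k with
  | zero =>
    rw [blockX_zero_eq_reindex]
    exact AlgEquiv.spectrum_eq (Matrix.reindexAlgEquiv ℂ ℂ _) A
  | succ k ih =>
    rw [← ih (Fin.init E), ← spectrum_fromBlocks_self (blockX A k (Fin.init E))
      ((1 : Matrix (Fin (2 ^ k)) (Fin (2 ^ k)) ℂ) ⊗ₖ E (Fin.last k))]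
    exact AlgEquiv.spectrum_eq (Matrix.reindexAlgEquiv ℂ ℂ (blockEquiv n k)) _

lemma continuous_blockX {n : ℕ} (k : ℕ) :
    Continuous fun q : Matrix (Fin n) (Fin n) ℂ × (Fin k → Matrix (Fin n) (Fin n) ℂ) =>
      blockX q.1 k q.2 := by
  have hkr : ∀ j : ℕ, Continuous fun H : Matrix (Fin n) (Fin n) ℂ =>
      (1 : Matrix (Fin (2 ^ j)) (Fin (2 ^ j)) ℂ) ⊗ₖ H := fun j =>
    continuous_matrix fun a b => continuous_const.mul (continuous_id.matrix_elem _ _)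
  induction k with
  | zero => exact (hkr 0).comp continuous_fst
  | succ k ih =>
    have h1 : Continuous fun q : Matrix (Fin n) (Fin n) ℂ ×
        (Fin (k + 1) → Matrix (Fin n) (Fin n) ℂ) => blockX q.1 k (Fin.init q.2) :=
      ih.comp (continuous_fst.prodMk (continuous_pi fun i =>
        (continuous_apply i.castSucc).comp continuous_snd))
    exact (h1.matrix_fromBlocks ((hkr k).comp ((continuous_apply (Fin.last k)).comp
      continuous_snd)) continuous_const h1).matrix_reindex _ _

end BlockStructure

/-! ### Fréchet derivatives as blocks -/

/-- The upper right block of `f(X_k)`, where `X_k` is built from `A` and `E₁, …, E_k`. -/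
noncomputable def frechetBlock (f : ℂ → ℂ) {n : ℕ} (k : ℕ) (A : Matrix (Fin n) (Fin n) ℂ)
    (E : Fin k → Matrix (Fin n) (Fin n) ℂ) : Matrix (Fin n) (Fin n) ℂ :=
  upperRightBlock (matFun f (blockX A k E))

lemma frechetBlock_zero (f : ℂ → ℂ) {n : ℕ} (A : Matrix (Fin n) (Fin n) ℂ)
    (E : Fin 0 → Matrix (Fin n) (Fin n) ℂ) : frechetBlock f 0 A E = matFun f A := by
  rw [frechetBlock, blockX_zero_eq_reindex, matFun_reindex]
  ext a b
  simp [upperRightBlock, oneBlockEquiv]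

section Frechet

attribute [local instance] Matrix.linftyOpNormedRing Matrix.linftyOpNormedAlgebra

variable {n : ℕ} {Ω : Set ℂ} {f : ℂ → ℂ}

/-- The upper right block as a linear map. -/
def upperRightBlockLin (n k : ℕ) :
    Matrix (Fin (2 ^ k) × Fin n) (Fin (2 ^ k) × Fin n) ℂ →ₗ[ℂ] Matrix (Fin n) (Fin n) ℂ where
  toFun := upperRightBlock
  map_add' _ _ := rfl
  map_smul' _ _ := rfl

/-- The derivative of the upper right block of `f(X_k)` with respect to `A` is the upper right
block of `f(X_{k+1})`, because moving `A` by `H` moves `X_k` by `I ⊗ H`. -/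
theorem exists_hasFDerivAt_frechetBlock (hΩ : IsOpen Ω) (hf : DifferentiableOn ℂ f Ω) {k : ℕ}
    {A : Matrix (Fin n) (Fin n) ℂ} (hA : spectrum ℂ A ⊆ Ω)
    (E : Fin k → Matrix (Fin n) (Fin n) ℂ) :
    ∃ D : Matrix (Fin n) (Fin n) ℂ →L[ℂ] Matrix (Fin n) (Fin n) ℂ,
      HasFDerivAt (fun B => frechetBlock f k B E) D A ∧
      ∀ H, frechetBlock f (k + 1) A (Fin.snoc E H) = D H := by
  obtain ⟨D, hD, hDY⟩ := exists_hasFDerivAt_matFun hΩ hf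
    (X := blockX A k E) (by rwa [spectrum_blockX])
  let T := (upperRightBlockLin n k).toContinuousLinearMap
  let K : Matrix (Fin n) (Fin n) ℂ →ₗ[ℂ] Matrix (Fin (2 ^ k) × Fin n) (Fin (2 ^ k) × Fin n) ℂ :=
    Matrix.kroneckerBilinear (R := ℂ) (1 : Matrix (Fin (2 ^ k)) (Fin (2 ^ k)) ℂ)
  let S := K.toContinuousLinearMap
  have hX : HasFDerivAt (fun B => blockX B k E) S A := by
    have h : (fun B => blockX B k E) = fun B => blockX 0 k E + S B := by
      funext B
      conv_lhs => rw [← zero_add B, blockX_add]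
      rfl
    rw [h]
    exact S.hasFDerivAt.const_add _
  have hfX : HasFDerivAt (matFun f ∘ fun B => blockX B k E) (D.comp S) A := hD.comp A hX
  refine ⟨T.comp (D.comp S), HasFDerivAt.comp A T.hasFDerivAt hfX, fun H => ?_⟩
  rw [frechetBlock, blockX, matFun_reindex, upperRightBlock_reindex, Fin.init_snoc,
    Fin.snoc_last, hDY]
  rfl

/-- Multilinearity passes from `f(X_k)` to its derivative, by uniqueness of derivatives. -/
lemma frechetBlock_update (hΩ : IsOpen Ω) (hf : DifferentiableOn ℂ f Ω) (k : ℕ)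
    {A : Matrix (Fin n) (Fin n) ℂ} (hA : spectrum ℂ A ⊆ Ω)
    (E : Fin k → Matrix (Fin n) (Fin n) ℂ) (i : Fin k) (c : ℂ) (x y : Matrix (Fin n) (Fin n) ℂ) :
    frechetBlock f k A (Function.update E i (c • x + y)) =
      c • frechetBlock f k A (Function.update E i x) +
        frechetBlock f k A (Function.update E i y) := by
  induction k generalizing A with
  | zero => exact i.elim0
  | succ k ih =>
    rw [← Fin.snoc_init_self E]
    induction i using Fin.lastCases with
    | last =>
      obtain ⟨D, -, hD⟩ := exists_hasFDerivAt_frechetBlock hΩ hf hA (Fin.init E)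
      simp only [Fin.update_snoc_last, hD, map_add, map_smul]
    | cast j =>
      simp only [← Fin.snoc_update]
      obtain ⟨D, hD, hDs⟩ := exists_hasFDerivAt_frechetBlock hΩ hf hA
        (Function.update (Fin.init E) j (c • x + y))
      obtain ⟨D₁, hD₁, hDs₁⟩ := exists_hasFDerivAt_frechetBlock hΩ hf hA
        (Function.update (Fin.init E) j x)
      obtain ⟨D₂, hD₂, hDs₂⟩ := exists_hasFDerivAt_frechetBlock hΩ hf hA
        (Function.update (Fin.init E) j y)
      have hev : ∀ᶠ B in 𝓝 A, frechetBlock f k B (Function.update (Fin.init E) j (c • x + y)) =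
          c • frechetBlock f k B (Function.update (Fin.init E) j x) +
            frechetBlock f k B (Function.update (Fin.init E) j y) := by
        filter_upwards [eventually_spectrum_subset hΩ hA] with B hB
        exact ih hB _ _
      have hD' := ((hD₁.const_smul c).add hD₂).congr_of_eventuallyEq hev
      rw [hDs, hDs₁, hDs₂, hD.unique hD']
      rfl

lemma exists_multilinearMap_frechetBlock (hΩ : IsOpen Ω) (hf : DifferentiableOn ℂ f Ω) (k : ℕ)
    {A : Matrix (Fin n) (Fin n) ℂ} (hA : spectrum ℂ A ⊆ Ω) :
    ∃ L : MultilinearMap ℂ (fun _ : Fin k => Matrix (Fin n) (Fin n) ℂ) (Matrix (Fin n) (Fin n) ℂ),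
      ∀ E, L E = frechetBlock f k A E := by
  have hadd (E : Fin k → Matrix (Fin n) (Fin n) ℂ) (i : Fin k) (x y : Matrix (Fin n) (Fin n) ℂ) :
      frechetBlock f k A (Function.update E i (x + y)) =
        frechetBlock f k A (Function.update E i x) +
          frechetBlock f k A (Function.update E i y) := by
    simpa only [one_smul] using frechetBlock_update hΩ hf k hA E i 1 x y
  refine ⟨MultilinearMap.mk' (frechetBlock f k A) hadd fun E i c x => ?_, fun E => rfl⟩
  have h0 : frechetBlock f k A (Function.update E i 0) = 0 := by
    simpa using hadd E i 0 0
  simpa only [add_zero, h0] using frechetBlock_update hΩ hf k hA E i c x 0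

/-- The Fréchet derivatives of `f` are the upper right blocks of the matrices `f(X_k)`. -/
theorem isFrechetDeriv_of_eq_frechetBlock (hΩ : IsOpen Ω) (hf : DifferentiableOn ℂ f Ω) (k : ℕ)
    {A : Matrix (Fin n) (Fin n) ℂ} (hA : spectrum ℂ A ⊆ Ω)
    (L : MultilinearMap ℂ (fun _ : Fin k => Matrix (Fin n) (Fin n) ℂ) (Matrix (Fin n) (Fin n) ℂ))
    (hL : ∀ E, L E = frechetBlock f k A E) : IsFrechetDeriv Ω f k A L := by
  induction k generalizing A with
  | zero =>
    rw [IsFrechetDeriv, hL, frechetBlock_zero]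
    exact isMatFun_matFun hΩ hf hA
  | succ k ih =>
    have hex : ∀ B : Matrix (Fin n) (Fin n) ℂ, ∃ G : MultilinearMap ℂ
        (fun _ : Fin k => Matrix (Fin n) (Fin n) ℂ) (Matrix (Fin n) (Fin n) ℂ),
        spectrum ℂ B ⊆ Ω → ∀ E, G E = frechetBlock f k B E := by
      intro B
      by_cases hB : spectrum ℂ B ⊆ Ω
      · obtain ⟨G, hG⟩ := exists_multilinearMap_frechetBlock hΩ hf k hB
        exact ⟨G, fun _ => hG⟩
      · exact ⟨0, fun h => absurd h hB⟩
    choose G hG using hex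
    have hev := eventually_spectrum_subset hΩ hA
    refine ⟨G, ?_, fun E => ?_⟩
    · filter_upwards [hev] with B hB
      exact ih hB (G B) (hG B hB)
    · obtain ⟨D, hD, hDs⟩ := exists_hasFDerivAt_frechetBlock hΩ hf hA E
      have hD0 := hasFDerivAt_iff_isLittleO_nhds_zero.1 hD
      refine IsLittleO.congr' hD0 ?_ EventuallyEq.rfl
      have ht : Tendsto (fun H => A + H) (𝓝 0) (𝓝 A) := by
        have : Continuous fun H : Matrix (Fin n) (Fin n) ℂ => A + H :=
          continuous_const.add continuous_id
        simpa using this.tendsto 0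
      filter_upwards [ht.eventually hev] with H hH
      rw [hG _ hH, hG _ hA, hL, hDs]
      rfl

lemma continuousOn_frechetBlock (hΩ : IsOpen Ω) (hf : DifferentiableOn ℂ f Ω) (k : ℕ) :
    ContinuousOn (fun q : Matrix (Fin n) (Fin n) ℂ × (Fin k → Matrix (Fin n) (Fin n) ℂ) =>
      frechetBlock f k q.1 q.2) ({A | spectrum ℂ A ⊆ Ω} ×ˢ Set.univ) := by
  rintro ⟨A, E⟩ ⟨hA, -⟩
  obtain ⟨D, hD, -⟩ := exists_hasFDerivAt_matFun hΩ hf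
    (X := blockX A k E) (by rwa [spectrum_blockX])
  have h1 : ContinuousAt (fun q : Matrix (Fin n) (Fin n) ℂ × (Fin k → Matrix (Fin n) (Fin n) ℂ) =>
      matFun f (blockX q.1 k q.2)) (A, E) :=
    ContinuousAt.comp (f := fun q : Matrix (Fin n) (Fin n) ℂ ×
        (Fin k → Matrix (Fin n) (Fin n) ℂ) => blockX q.1 k q.2) (x := (A, E))
      hD.continuousAt (continuous_blockX k).continuousAt
  exact ((upperRightBlockLin n k).toContinuousLinearMap.continuous.continuousAt.comp
    h1).continuousWithinAt

end Frechet

theorem theorem3p1 {n k m : ℕ} (hk : 1 ≤ k) (hm : 1 ≤ m)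
    (Ω : Set ℂ) (hΩ : IsOpen Ω) (f : ℂ → ℂ)
    (hf : ContDiffOn ℂ (((k + 1) * m - 1 : ℕ) : WithTop ℕ∞) f Ω)
    (A₀ : Matrix (Fin n) (Fin n) ℂ) (E : Fin k → Matrix (Fin n) (Fin n) ℂ)
    (hA : ∀ᶠ x : Fin k → ℝ in 𝓝 0, A₀ + ∑ i, (x i : ℂ) • E i ∈ matrixClass n Ω m) :
    ∃ (U : Set (Matrix (Fin n) (Fin n) ℂ))
      (L : Matrix (Fin n) (Fin n) ℂ →
        MultilinearMap ℂ (fun _ : Fin k => Matrix (Fin n) (Fin n) ℂ)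
          (Matrix (Fin n) (Fin n) ℂ)),
      IsOpen U ∧ A₀ ∈ U ∧
      (∀ A ∈ U, IsFrechetDeriv Ω f k A (L A)) ∧
      ContinuousOn
        (fun q : Matrix (Fin n) (Fin n) ℂ × (Fin k → Matrix (Fin n) (Fin n) ℂ) => L q.1 q.2)
        (U ×ˢ Set.univ) ∧
      ∃ F : Matrix (Fin (2 ^ k) × Fin n) (Fin (2 ^ k) × Fin n) ℂ,
        IsMatFun Ω f (blockX A₀ k E) F ∧ L A₀ E = upperRightBlock F := by
  -- The order of differentiability is at least `2 * 1 - 1 = 1`, so `f` is holomorphic on `Ω`.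
  have hN : (k + 1) * m - 1 ≠ 0 := by
    have : 2 * 1 ≤ (k + 1) * m := Nat.mul_le_mul (by omega) hm
    omega
  have hfd : DifferentiableOn ℂ f Ω := hf.differentiableOn (by exact_mod_cast hN)
  have hA₀ : spectrum ℂ A₀ ⊆ Ω := by
    simpa using hA.self_of_nhds.1
  have hex : ∀ A : Matrix (Fin n) (Fin n) ℂ, ∃ L : MultilinearMap ℂ
      (fun _ : Fin k => Matrix (Fin n) (Fin n) ℂ) (Matrix (Fin n) (Fin n) ℂ),
      spectrum ℂ A ⊆ Ω → ∀ E, L E = frechetBlock f k A E := by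
    intro A
    by_cases h : spectrum ℂ A ⊆ Ω
    · obtain ⟨L, hL⟩ := exists_multilinearMap_frechetBlock hΩ hfd k h
      exact ⟨L, fun _ => hL⟩
    · exact ⟨0, fun h' => absurd h' h⟩
  choose L hL using hex
  refine ⟨{A | spectrum ℂ A ⊆ Ω}, L, ?_, hA₀, fun A hA =>
    isFrechetDeriv_of_eq_frechetBlock hΩ hfd k hA (L A) (hL A hA), ?_,
    matFun f (blockX A₀ k E), isMatFun_matFun hΩ hfd (by rwa [spectrum_blockX]), hL A₀ hA₀ E⟩
  · exact isOpen_iff_mem_nhds.2 fun A hA => eventually_spectrum_subset hΩ hA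
  · exact (continuousOn_frechetBlock hΩ hfd k).congr fun q hq => hL q.1 hq.1 q.2
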